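/- Let $\Gamma$ be the first Grigorchuk group, that is, the group of automorphisms of the rooted binary tree $\{0,1\}^*$ generated by the involutions $a,b,c,d$ with $a(0w)=1w$, $a(1w)=0w$, $b=(a,c)$, $c=(a,d)$, $d=(1,b)$, where $x=(y,z)$ means $x(0w)=0\,y(w)$ and $x(1w)=1\,z(w)$. For a group $G$, let $P_{\hat 2}(G)=\varprojlim G/N$, over all normal subgroups $N$ of $G$ whose index is a power of $2$, be its pro-$2$ completion, and let $P\mathcal S(G)=\varprojlim G/N$, over all normal subgroups $N$ of $G$ with soluble quotient $G/N$, be its true prosoluble completion; both carry the inverse limit topology for the discrete topologies on the quotients $G/N$. A subgroup $\Delta$ of a profinite group $G$ has the congruence subgroup property if every normal subgroup of finite index of $\Delta$ is of the form $M\cap\Delta$ for some open normal subgroup $M$ of $G$. Suppose that $\Delta$ is a finitely generated (as an abstract group) dense subgroup of $P_{\hat 2}(\Gamma)$ that properly contains the canonical image of $\Gamma$ and has the congruence subgroup property, and let $\psi:\Gamma\to\Delta$ be the canonical homomorphism. Then $\Gamma$ and $\Delta$ are residually soluble, $\psi$ is injective and is not an isomorphism, and the homomorphism $$P\mathcal S(\psi):P\mathcal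 S(\Gamma)\longrightarrow P\mathcal S(\Delta)$$ induced by $\psi$ is an isomorphism of topological groups. (Thus such a $\Delta$ would give a solution of the prosoluble analogue of Grothendieck's problem, which asks for a homomorphism of residually soluble groups that is not an isomorphism but induces an isomorphism of true prosoluble completions.) -/

import Mathlib

/-! ### Completion with respect to a directed family of normal subgroups -/

/-- A (nonempty) directed family of normal subgroups of a group `G`. -/
structure DirectedNormalFamily (G : Type*) [Group G] where
  carrier : Set (Subgroup G)
  normal : ∀ N ∈ carrier, N.Normal
  nonempty : carrier.Nonempty
  directed : ∀ M ∈ carrier, ∀ N ∈ carrier, ∃ K ∈ carrier, K ≤ M ⊓ N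

namespace DirectedNormalFamily

variable {G : Type*} [Group G]

instance (𝒩 : DirectedNormalFamily G) (N : 𝒩.carrier) : (N : Subgroup G).Normal :=
  𝒩.normal N N.2

/-- The compatible families in `∏ G ⧸ N`, that is, the inverse limit of the quotients `G ⧸ N`,
for `N` in the family, along the canonical projections. -/
def limit (𝒩 : DirectedNormalFamily G) : Subgroup (∀ N : 𝒩.carrier, G ⧸ (N : Subgroup G)) where
  carrier := {x | ∀ (M N : 𝒩.carrier) (h : (N : Subgroup G) ≤ (M : Subgroup G)),
    QuotientGroup.map (N : Subgroup G) (M : Subgroup G) (MonoidHom.id G)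
      (h.trans_eq (Subgroup.comap_id _).symm) (x N) = x M}
  mul_mem' := by
    intro x y hx hy M N h
    simp only [Pi.mul_apply, map_mul]
    rw [hx M N h, hy M N h]
  one_mem' := by
    intro M N h
    simp only [Pi.one_apply, map_one]
  inv_mem' := by
    intro x hx M N h
    simp only [Pi.inv_apply, map_inv]
    rw [hx M N h]

/-- The pro-`𝒩` completion of `G`, as the inverse limit of the quotients `G ⧸ N`. -/
def Completion (𝒩 : DirectedNormalFamily G) : Type _ := 𝒩.limit

namespace Completion

instance (𝒩 : DirectedNormalFamily G) : Group 𝒩.Completion :=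
  inferInstanceAs (Group 𝒩.limit)

/-- The projection of the completion to `G ⧸ N`. -/
def proj (𝒩 : DirectedNormalFamily G) (N : 𝒩.carrier) :
    𝒩.Completion →* G ⧸ (N : Subgroup G) where
  toFun x := x.1 N
  map_one' := rfl
  map_mul' _ _ := rfl

/-- The inverse limit topology, for the discrete topology on each `G ⧸ N` (whether or not `G`
happens to carry a topology). -/
instance (𝒩 : DirectedNormalFamily G) : TopologicalSpace 𝒩.Completion :=
  ⨅ N : 𝒩.carrier, TopologicalSpace.induced (proj 𝒩 N) ⊥

instance (𝒩 : DirectedNormalFamily G) : IsTopologicalGroup 𝒩.Completion :=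
  topologicalGroup_iInf fun N => by
    let : TopologicalSpace (G ⧸ (N : Subgroup G)) := ⊥
    have : DiscreteTopology (G ⧸ (N : Subgroup G)) := ⟨rfl⟩
    exact topologicalGroup_induced (proj 𝒩 N)

/-- The canonical homomorphism `G → P𝒩(G)`. -/
def of (𝒩 : DirectedNormalFamily G) : G →* 𝒩.Completion where
  toFun g := ⟨fun N => QuotientGroup.mk' (N : Subgroup G) g, fun _ _ _ => rfl⟩
  map_one' := rfl
  map_mul' _ _ := rfl

/-- Functoriality: a homomorphism `ψ : G → H` such that the preimage of each group of the family
`𝒩` on `H` is in the family `ℳ` on `G` induces `Pℳ(G) → P𝒩(H)`, the inverse limit of the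
homomorphisms `G ⧸ ψ⁻¹(N) → H ⧸ N`. -/
def map {H : Type*} [Group H] (ℳ : DirectedNormalFamily G) (𝒩 : DirectedNormalFamily H)
    (ψ : G →* H) (hψ : ∀ N ∈ 𝒩.carrier, N.comap ψ ∈ ℳ.carrier) :
    ℳ.Completion →* 𝒩.Completion where
  toFun x := ⟨fun N => QuotientGroup.map ((N : Subgroup H).comap ψ) (N : Subgroup H) ψ le_rfl
      (x.1 ⟨(N : Subgroup H).comap ψ, hψ N N.2⟩), by
    intro M N h
    have hx := x.2 ⟨(M : Subgroup H).comap ψ, hψ M M.2⟩ ⟨(N : Subgroup H).comap ψ, hψ N N.2⟩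
      (Subgroup.comap_mono h)
    change QuotientGroup.map (N : Subgroup H) (M : Subgroup H) (MonoidHom.id H) _
      (QuotientGroup.map ((N : Subgroup H).comap ψ) (N : Subgroup H) ψ le_rfl _) =
      QuotientGroup.map ((M : Subgroup H).comap ψ) (M : Subgroup H) ψ le_rfl _
    refine Eq.trans ?_ (congrArg _ hx)
    generalize x.1 ⟨(N : Subgroup H).comap ψ, hψ N N.2⟩ = q
    obtain ⟨g, rfl⟩ := QuotientGroup.mk_surjective q
    rfl⟩
  map_one' := Subtype.ext <| funext fun _ => map_one _
  map_mul' _ _ := Subtype.ext <| funext fun _ => map_mul _ _ _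

/-- `map` extends `ψ`. -/
theorem map_of {H : Type*} [Group H] (ℳ : DirectedNormalFamily G) (𝒩 : DirectedNormalFamily H)
    (ψ : G →* H) (hψ : ∀ N ∈ 𝒩.carrier, N.comap ψ ∈ ℳ.carrier) (g : G) :
    map ℳ 𝒩 ψ hψ (of ℳ g) = of 𝒩 (ψ g) := rfl

/-- `map` is continuous. -/
theorem continuous_map {H : Type*} [Group H] (ℳ : DirectedNormalFamily G)
    (𝒩 : DirectedNormalFamily H) (ψ : G →* H)
    (hψ : ∀ N ∈ 𝒩.carrier, N.comap ψ ∈ ℳ.carrier) : Continuous (map ℳ 𝒩 ψ hψ) := by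
  refine continuous_iInf_rng.2 fun N => continuous_induced_rng.2 ?_
  refine continuous_iInf_dom (i := ⟨(N : Subgroup H).comap ψ, hψ N N.2⟩) ?_
  have h : @Continuous _ _ ⊥ ⊥ (QuotientGroup.map ((N : Subgroup H).comap ψ)
    (N : Subgroup H) ψ le_rfl) := continuous_bot
  have h2 := @Continuous.comp _ _ _
    (TopologicalSpace.induced (proj ℳ ⟨(N : Subgroup H).comap ψ, hψ N N.2⟩) ⊥) ⊥ ⊥ _ _ h
    continuous_induced_dom
  exact h2

/-- The canonical image of `G` is dense in its completion. -/
theorem denseRange_of (𝒩 : DirectedNormalFamily G) : DenseRange (of 𝒩) := by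
  intro x
  rw [mem_closure_iff_nhds]
  intro U hU
  have hdir : ∀ I : Set 𝒩.carrier, I.Finite →
      ∃ K : 𝒩.carrier, ∀ N ∈ I, (K : Subgroup G) ≤ (N : Subgroup G) := by
    intro I hI
    induction I, hI using Set.Finite.induction_on with
    | empty => exact ⟨⟨_, 𝒩.nonempty.some_mem⟩, by simp⟩
    | @insert M I _ _ ih =>
      obtain ⟨K, hK⟩ := ih
      obtain ⟨L, hL, hLK⟩ := 𝒩.directed K K.2 M M.2
      refine ⟨⟨L, hL⟩, fun N hN => ?_⟩
      rcases hN with rfl | hN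
      · exact hLK.trans inf_le_right
      · exact (hLK.trans inf_le_left).trans (hK N hN)
  rw [nhds_iInf, Filter.mem_iInf] at hU
  obtain ⟨I, hI, V, hV, rfl⟩ := hU
  obtain ⟨K, hK⟩ := hdir I hI
  obtain ⟨g, hg⟩ := QuotientGroup.mk_surjective (x.1 K)
  refine ⟨of 𝒩 g, Set.mem_iInter.2 fun N => ?_, g, rfl⟩
  have hN := hV N
  rw [@nhds_induced _ _ ⊥, Filter.mem_comap] at hN
  obtain ⟨t, ht, htV⟩ := hN
  apply htV
  have hx := x.2 N K (hK N N.2)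
  rw [← hg] at hx
  have : proj 𝒩 N (of 𝒩 g) = proj 𝒩 N x := hx
  rw [Set.mem_preimage, this]
  exact @mem_of_mem_nhds _ ⊥ _ _ ht

end Completion

end DirectedNormalFamily

/-! ### The pro-`p` completion and the true prosoluble completion -/

/-- The normal subgroups of `G` of index a power of `p`. -/
def proPFamily (p : ℕ) [Fact p.Prime] (G : Type*) [Group G] : DirectedNormalFamily G where
  carrier := {N | N.Normal ∧ ∃ k : ℕ, N.index = p ^ k}
  normal _ hN := hN.1
  nonempty := ⟨⊤, inferInstance, 0, by simp⟩
  directed := by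
    rintro M ⟨hM, m, hm⟩ N ⟨hN, n, hn⟩
    refine ⟨M ⊓ N, ⟨inferInstance, ?_⟩, le_rfl⟩
    have h1 : M.relIndex N ∣ p ^ m := hm ▸ Subgroup.relIndex_dvd_index_of_normal M N
    obtain ⟨k, -, hk⟩ := (Nat.dvd_prime_pow Fact.out).1 h1
    refine ⟨k + n, ?_⟩
    rw [pow_add, ← hk, ← hn, ← Subgroup.inf_relIndex_right]
    exact (Subgroup.relIndex_mul_index inf_le_right).symm

/-- The pro-`p` completion of `G`. -/
abbrev ProPCompletion (p : ℕ) [Fact p.Prime] (G : Type*) [Group G] : Type _ :=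
  (proPFamily p G).Completion

/-- The canonical homomorphism of `G` to its pro-`p` completion. -/
abbrev toProPCompletion (p : ℕ) [Fact p.Prime] (G : Type*) [Group G] : G →* ProPCompletion p G :=
  DirectedNormalFamily.Completion.of (proPFamily p G)

/-- The normal subgroups of `G` with soluble quotient. -/
def solubleFamily (G : Type*) [Group G] : DirectedNormalFamily G where
  carrier := {N | ∃ _ : N.Normal, Group.IsSolvable (G ⧸ N)}
  normal _ hN := hN.1
  nonempty := by
    have : Subsingleton (G ⧸ (⊤ : Subgroup G)) := QuotientGroup.subsingleton_quotient_top
    exact ⟨⊤, inferInstance, inferInstance⟩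
  directed := by
    rintro M ⟨hM, hMs⟩ N ⟨hN, hNs⟩
    refine ⟨M ⊓ N, ⟨inferInstance, ?_⟩, le_rfl⟩
    have hker : ((QuotientGroup.mk' M).prod (QuotientGroup.mk' N)).ker = M ⊓ N := by
      ext g
      simp [MonoidHom.mem_ker]
    refine Group.isSolvable_of_isSolvable_injective
      (f := QuotientGroup.lift (M ⊓ N) ((QuotientGroup.mk' M).prod (QuotientGroup.mk' N)) hker.ge) ?_
    rw [injective_iff_map_eq_one]
    intro q hq
    obtain ⟨g, rfl⟩ := QuotientGroup.mk_surjective q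
    rw [QuotientGroup.eq_one_iff, ← hker]
    exact hq

/-- The true prosoluble completion `P𝒮(G)`. -/
abbrev TrueProsolubleCompletion (G : Type*) [Group G] : Type _ :=
  (solubleFamily G).Completion

theorem comap_mem_solubleFamily {G H : Type*} [Group G] [Group H] (ψ : G →* H)
    (N : Subgroup H) (hN : N ∈ (solubleFamily H).carrier) :
    N.comap ψ ∈ (solubleFamily G).carrier := by
  obtain ⟨hn, hs⟩ := hN
  refine ⟨inferInstance, Group.isSolvable_of_isSolvable_injective
    (f := QuotientGroup.map (N.comap ψ) N ψ le_rfl) ?_⟩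
  rw [injective_iff_map_eq_one]
  intro q hq
  obtain ⟨g, rfl⟩ := QuotientGroup.mk_surjective q
  rw [QuotientGroup.eq_one_iff, Subgroup.mem_comap, ← QuotientGroup.eq_one_iff]
  exact hq

/-- The continuous homomorphism `P𝒮(ψ) : P𝒮(G) → P𝒮(H)` induced by `ψ : G → H`. -/
def TrueProsolubleCompletion.map {G H : Type*} [Group G] [Group H] (ψ : G →* H) :
    TrueProsolubleCompletion G →* TrueProsolubleCompletion H :=
  DirectedNormalFamily.Completion.map (solubleFamily G) (solubleFamily H) ψ
    (comap_mem_solubleFamily ψ)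

/-- `G` is residually soluble: each nontrivial element survives in some soluble quotient. -/
def IsResiduallySoluble (G : Type*) [Group G] : Prop :=
  ∀ g : G, g ≠ 1 → ∃ N ∈ (solubleFamily G).carrier, g ∉ N

/-! ### The congruence subgroup property -/

/-- A subgroup `Δ` of a topological (in practice profinite) group `G` has the congruence subgroup
property: every normal subgroup of finite index of `Δ` is the intersection with `Δ` of an open
normal subgroup of `G`. -/
def HasCongruenceSubgroupProperty {G : Type*} [Group G] [TopologicalSpace G]
    (Δ : Subgroup G) : Prop :=
  ∀ N : Subgroup Δ, N.Normal → N.FiniteIndex →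
    ∃ M : Subgroup G, M.Normal ∧ IsOpen (M : Set G) ∧ N = M.subgroupOf Δ

/-! ### The first Grigorchuk group

It acts on the rooted binary tree, whose vertices are the finite binary words; `false` and `true`
stand for the letters `0` and `1`. -/

namespace Grigorchuk

/-- `a` exchanges the two subtrees at the root. -/
def actA : List Bool → List Bool
  | [] => []
  | x :: w => (!x) :: w

mutual

/-- `b = (a, c)` -/
def actB : List Bool → List Bool
  | [] => []
  | false :: w => false :: actA w
  | true :: w => true :: actC w

/-- `c = (a, d)` -/
def actC : List Bool → List Bool
  | [] => []
  | false :: w => false :: actA w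
  | true :: w => true :: actD w

/-- `d = (1, b)` -/
def actD : List Bool → List Bool
  | [] => []
  | false :: w => false :: w
  | true :: w => true :: actB w

end

theorem actA_involutive : Function.Involutive actA := by
  intro w
  cases w <;> simp [actA]

theorem actBCD_involutive (w : List Bool) :
    actB (actB w) = w ∧ actC (actC w) = w ∧ actD (actD w) = w := by
  induction w with
  | nil => simp [actB, actC, actD]
  | cons x w ih =>
    cases x <;> simp [actB, actC, actD, actA_involutive w, ih]

/-- The generator `a`. -/
def a : Equiv.Perm (List Bool) := actA_involutive.toPerm actA

/-- The generator `b`. -/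
def b : Equiv.Perm (List Bool) :=
  Function.Involutive.toPerm actB fun w => (actBCD_involutive w).1

/-- The generator `c`. -/
def c : Equiv.Perm (List Bool) :=
  Function.Involutive.toPerm actC fun w => (actBCD_involutive w).2.1

/-- The generator `d`. -/
def d : Equiv.Perm (List Bool) :=
  Function.Involutive.toPerm actD fun w => (actBCD_involutive w).2.2

end Grigorchuk

/-- The first Grigorchuk group, generated by `a`, `b`, `c`, `d`. -/
def grigorchukGroup : Subgroup (Equiv.Perm (List Bool)) :=
  Subgroup.closure {Grigorchuk.a, Grigorchuk.b, Grigorchuk.c, Grigorchuk.d}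

-- The group Γ is a finitely generated, residually finite 2-group. Under the congruence subgroup
-- property, every normal subgroup of finite index in Δ is cut out by an open subgroup of the pro-2
-- completion. The dense image of Γ therefore meets each of its cosets (`exists_inv_mul_mem`), and Γ
-- maps onto every finite quotient of Δ. Hence all finite quotients of Δ, like those of Γ, are
-- 2-groups.
--
-- A finitely generated soluble group whose finite quotients are all p-groups is finite
-- (`finite_of_isSolvable`): an infinite one would have an infinite, finitely generated, virtually
-- abelian quotient, and these have finite quotients of order divisible by any given prime. So the
-- soluble quotients of Γ and of Δ are finite 2-groups, and the true prosoluble completions involve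
-- only normal subgroups of finite index. Those of Γ are the preimages of kernels of coordinate
-- projections restricted to Δ, and Γ maps onto the soluble quotients of Δ. By
-- `exists_continuousMulEquiv` this makes the induced map a topological isomorphism.

namespace Grigorchuk

-- Wreath recursion for the generators

/-- The permutation `(f, g)` of the binary tree: `f` on the left and `g` on the right subtree. -/
def pair (f g : Equiv.Perm (List Bool)) : Equiv.Perm (List Bool) where
  toFun
    | [] => []
    | false :: w => false :: f w
    | true :: w => true :: g w
  invFun
    | [] => []
    | false :: w => false :: f⁻¹ w
    | true :: w => true :: g⁻¹ w
  left_inv := by rintro (_ | ⟨_ | _, w⟩) <;> simp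
  right_inv := by rintro (_ | ⟨_ | _, w⟩) <;> simp

theorem pair_mul (f g f' g' : Equiv.Perm (List Bool)) :
    pair f g * pair f' g' = pair (f * f') (g * g') := by
  ext1 w
  rcases w with _ | ⟨_ | _, w⟩ <;> rfl

theorem pair_one : pair 1 1 = 1 := by
  ext1 w
  rcases w with _ | ⟨_ | _, w⟩ <;> rfl

theorem pair_pow (f g : Equiv.Perm (List Bool)) (n : ℕ) : pair f g ^ n = pair (f ^ n) (g ^ n) := by
  induction n with
  | zero => simp [pair_one]
  | succ n ih => rw [pow_succ, ih, pair_mul, pow_succ, pow_succ]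

theorem a_mul_self : a * a = 1 := Equiv.ext actA_involutive

theorem a_mul_pair (f g : Equiv.Perm (List Bool)) : a * pair f g = pair g f * a := by
  ext1 w
  rcases w with _ | ⟨_ | _, w⟩ <;> rfl

theorem b_eq_pair : b = pair a c := by
  ext1 w
  rcases w with _ | ⟨_ | _, w⟩ <;> rfl

theorem c_eq_pair : c = pair a d := by
  ext1 w
  rcases w with _ | ⟨_ | _, w⟩ <;> rfl

theorem d_eq_pair : d = pair 1 b := by
  ext1 w
  rcases w with _ | ⟨_ | _, w⟩ <;> rfl

theorem b_mul_self : b * b = 1 := Equiv.ext fun w => (actBCD_involutive w).1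

theorem c_mul_self : c * c = 1 := Equiv.ext fun w => (actBCD_involutive w).2.1

theorem d_mul_self : d * d = 1 := Equiv.ext fun w => (actBCD_involutive w).2.2

theorem act_klein (w : List Bool) :
    actB (actC w) = actD w ∧ actC (actD w) = actB w ∧ actD (actB w) = actC w := by
  induction w with
  | nil => simp [actB, actC, actD]
  | cons x w ih => cases x <;> simp [actB, actC, actD, actA_involutive w, ih]

theorem b_mul_c : b * c = d := Equiv.ext fun w => (act_klein w).1

theorem c_mul_d : c * d = b := Equiv.ext fun w => (act_klein w).2.1

theorem d_mul_b : d * b = c := Equiv.ext fun w => (act_klein w).2.2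

theorem c_mul_b : c * b = d := by rw [← c_mul_d, ← mul_assoc, c_mul_self, one_mul]

theorem d_mul_c : d * c = b := by rw [← d_mul_b, ← mul_assoc, d_mul_self, one_mul]

theorem b_mul_d : b * d = c := by rw [← b_mul_c, ← mul_assoc, b_mul_self, one_mul]

-- Weighted words in the generators

/-- The generators other than `a`. -/
inductive Letter
  | b
  | c
  | d

namespace Letter

/-- The permutation that a letter stands for. -/
def perm : Letter → Equiv.Perm (List Bool)
  | b => Grigorchuk.b
  | c => Grigorchuk.c
  | d => Grigorchuk.d

/-- Weights for which passing to sections is strictly contracting. -/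
def weight : Letter → ℕ
  | b => 4
  | c => 3
  | d => 2

/-- The product of two letters in the Klein four-group `{1, b, c, d}`. -/
def merge : Letter → Letter → Option Letter
  | b, b => none
  | c, c => none
  | d, d => none
  | b, c => some d
  | c, b => some d
  | c, d => some b
  | d, c => some b
  | b, d => some c
  | d, b => some c

end Letter

/-- The permutation of an element of the Klein four-group `{1, b, c, d}`. -/
def permOption : Option Letter → Equiv.Perm (List Bool)
  | none => 1
  | some x => x.perm

/-- The weight of an element of the Klein four-group `{1, b, c, d}`. -/
def weightOption : Option Letter → ℕ
  | none => 0
  | some x => x.weight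

theorem Letter.perm_mul_self (x : Letter) : x.perm * x.perm = 1 := by
  cases x
  exacts [b_mul_self, c_mul_self, d_mul_self]

theorem permOption_merge (x y : Letter) : permOption (x.merge y) = x.perm * y.perm := by
  cases x <;> cases y <;>
    simp [Letter.merge, permOption, Letter.perm, b_mul_self, c_mul_self, d_mul_self, b_mul_c,
      c_mul_d, d_mul_b, c_mul_b, d_mul_c, b_mul_d]

/-- Each of the weights 4, 3, 2 is less than the sum of the other two. Strictness lets the weight
drop when two letters become adjacent after a conjugation. -/
theorem weightOption_merge_lt (x y : Letter) :
    weightOption (x.merge y) < x.weight + y.weight := by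
  cases x <;> cases y <;> simp [Letter.merge, weightOption, Letter.weight]

/-- The value of a word in the generators; `none` stands for `a`. -/
def eval : List (Option Letter) → Equiv.Perm (List Bool)
  | [] => 1
  | none :: w => a * eval w
  | some x :: w => x.perm * eval w

/-- The weight of a word in the generators; `none` stands for `a`. -/
def wordWeight : List (Option Letter) → ℕ
  | [] => 0
  | none :: w => 3 + wordWeight w
  | some x :: w => x.weight + wordWeight w

theorem eval_append (u v : List (Option Letter)) : eval (u ++ v) = eval u * eval v := by
  induction u with
  | nil => simp [eval]
  | cons x u ih => cases x <;> simp [eval, ih, mul_assoc]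

theorem wordWeight_append (u v : List (Option Letter)) :
    wordWeight (u ++ v) = wordWeight u + wordWeight v := by
  induction u with
  | nil => simp [wordWeight]
  | cons x u ih => cases x <;> simp [wordWeight, ih, add_assoc]

/-- The alternating word `a x₁ a x₂ ⋯ a xₖ`. -/
def alternating : List Letter → List (Option Letter)
  | [] => []
  | x :: xs => none :: some x :: alternating xs

theorem alternating_append (xs ys : List Letter) :
    alternating (xs ++ ys) = alternating xs ++ alternating ys := by
  induction xs with
  | nil => rfl
  | cons x xs ih => simp [alternating, ih]

/-- The section of a letter at the vertex `0`. -/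
def sectionLeft : Letter → List (Option Letter)
  | .b => [none]
  | .c => [none]
  | .d => []

/-- The section of a letter at the vertex `1`. -/
def sectionRight : Letter → List (Option Letter)
  | .b => [some .c]
  | .c => [some .d]
  | .d => [some .b]

theorem perm_eq_pair (x : Letter) :
    x.perm = pair (eval (sectionLeft x)) (eval (sectionRight x)) := by
  cases x <;> simp [Letter.perm, sectionLeft, sectionRight, eval, ← b_eq_pair, ← c_eq_pair,
    ← d_eq_pair]

/-- With `a` of weight 3, the two sections of `b`, `c`, `d` together weigh 6, 5, 4, while `a x`
weighs 7, 6, 5: each factor `a x` loses one unit. -/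
theorem wordWeight_section_lt (x : Letter) :
    wordWeight (sectionLeft x) + wordWeight (sectionRight x) < 3 + x.weight := by
  cases x <;> simp [sectionLeft, sectionRight, wordWeight, Letter.weight]

/-- An alternating product of positive length is `(p, q)` or `(p, q) a` for words `p`, `q` of smaller
total weight. -/
theorem exists_eval_alternating (xs : List Letter) :
    ∃ p q : List (Option Letter),
      eval (alternating xs) = pair (eval p) (eval q) * a ^ xs.length ∧
      wordWeight p + wordWeight q + xs.length ≤ wordWeight (alternating xs) := by
  induction xs with
  | nil => exact ⟨[], [], by simp [alternating, eval, pair_one], by simp [wordWeight]⟩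
  | cons x xs ih =>
    obtain ⟨p, q, h, hw⟩ := ih
    refine ⟨sectionRight x ++ q, sectionLeft x ++ p, ?_, ?_⟩
    · rw [alternating, eval, eval, h, perm_eq_pair, ← mul_assoc (pair _ _), pair_mul, ← mul_assoc,
        a_mul_pair, eval_append, eval_append, mul_assoc, List.length_cons, pow_succ']
    · have := wordWeight_section_lt x
      simp only [wordWeight_append, alternating, wordWeight, List.length_cons]
      omega

-- The Grigorchuk group is a 2-group

/-- The order of the element is a power of two. -/
def HasTwoPowerOrder {G : Type*} [Group G] (g : G) : Prop := ∃ k : ℕ, g ^ 2 ^ k = 1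

theorem HasTwoPowerOrder.of_sq {G : Type*} [Group G] {g : G} (h : HasTwoPowerOrder (g * g)) :
    HasTwoPowerOrder g := by
  obtain ⟨k, hk⟩ := h
  exact ⟨k + 1, by rw [pow_succ', pow_mul, pow_two, hk]⟩

theorem HasTwoPowerOrder.of_mul_self {G : Type*} [Group G] {g : G} (h : g * g = 1) :
    HasTwoPowerOrder g := ⟨1, by rw [pow_one, pow_two, h]⟩

theorem HasTwoPowerOrder.mul_comm {G : Type*} [Group G] {g h : G}
    (H : HasTwoPowerOrder (g * h)) : HasTwoPowerOrder (h * g) := by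
  obtain ⟨k, hk⟩ := H
  refine ⟨k, ?_⟩
  have : h * g = g⁻¹ * (g * h) * g⁻¹⁻¹ := by group
  rw [this, conj_pow, hk]
  simp

theorem HasTwoPowerOrder.pair {f g : Equiv.Perm (List Bool)} (hf : HasTwoPowerOrder f)
    (hg : HasTwoPowerOrder g) : HasTwoPowerOrder (pair f g) := by
  obtain ⟨k, hk⟩ := hf
  obtain ⟨l, hl⟩ := hg
  refine ⟨k + l, ?_⟩
  rw [pair_pow, pow_add, pow_mul, hk, one_pow, _root_.mul_comm (2 ^ k), pow_mul, hl, one_pow, pair_one]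

/-- In even length the element is `(p, q)` with both sections lighter. In odd length it is `(p, q)
a`, whose square is `(pq, qp)`; the total weight of `p` and `q` is still smaller than that of the
word, since the length is positive. -/
theorem hasTwoPowerOrder_alternating (xs : List Letter)
    (ih : ∀ w, wordWeight w < wordWeight (alternating xs) → HasTwoPowerOrder (eval w)) :
    HasTwoPowerOrder (eval (alternating xs)) := by
  obtain ⟨p, q, h, hw⟩ := exists_eval_alternating xs
  rcases xs.length.eq_zero_or_pos with h0 | h0
  · rw [List.length_eq_zero_iff] at h0
    subst h0
    exact ⟨0, by simp [alternating, eval]⟩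
  rcases Nat.even_or_odd' xs.length with ⟨k, hk | hk⟩
  · rw [h, hk, pow_mul, pow_two, a_mul_self, one_pow, mul_one]
    exact (ih p (by omega)).pair (ih q (by omega))
  · rw [h, hk, pow_succ, pow_mul, pow_two, a_mul_self, one_pow, one_mul]
    apply HasTwoPowerOrder.of_sq
    rw [mul_assoc, ← mul_assoc a, a_mul_pair, mul_assoc, a_mul_self, mul_one, pair_mul,
      ← eval_append, ← eval_append]
    exact (ih _ (by rw [wordWeight_append]; omega)).pair (ih _ (by rw [wordWeight_append]; omega))

/-- Every word can be brought into the form `ε a x₁ ⋯ a xₖ δ` with `ε ∈ {1, b, c, d}` and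
`δ ∈ {1, a}` without increasing its weight. -/
theorem exists_normalForm (w : List (Option Letter)) :
    ∃ (ε : Option Letter) (xs : List Letter) (δ : Bool),
      eval w = permOption ε * eval (alternating xs) * eval (if δ then [none] else []) ∧
      weightOption ε + wordWeight (alternating xs) + wordWeight (if δ then [none] else []) ≤
        wordWeight w := by
  induction w with
  | nil => exact ⟨none, [], false, by simp [eval, permOption, alternating],
      by simp [wordWeight, weightOption, alternating]⟩
  | cons x w ih =>
    obtain ⟨ε, xs, δ, h, hw⟩ := ih
    rcases x with _ | x
    · rcases ε with _ | y
      · rcases xs with _ | ⟨y, ys⟩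
        · refine ⟨none, [], !δ, ?_, ?_⟩
          · cases δ <;> simp [eval, h, permOption, alternating, a_mul_self]
          · cases δ <;> simp_all [weightOption, wordWeight, alternating]
        · refine ⟨some y, ys, δ, ?_, ?_⟩
          · rw [eval, h, alternating, eval, eval, permOption, permOption]
            simp only [one_mul, ← mul_assoc, a_mul_self]
          · simp only [weightOption, wordWeight, alternating] at hw ⊢
            omega
      · refine ⟨none, y :: xs, δ, ?_, ?_⟩
        · rw [eval, h, alternating, eval, eval, permOption, permOption]
          simp only [one_mul, ← mul_assoc]
        · simp only [weightOption, wordWeight, alternating] at hw ⊢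
          omega
    · rcases ε with _ | y
      · refine ⟨some x, xs, δ, ?_, ?_⟩
        · rw [eval, h, permOption, permOption]
          simp only [one_mul, ← mul_assoc]
        · simp only [weightOption, wordWeight] at hw ⊢
          omega
      · refine ⟨x.merge y, xs, δ, ?_, ?_⟩
        · rw [eval, h, permOption_merge, permOption]
          simp only [← mul_assoc]
        · have := weightOption_merge_lt x y
          simp only [weightOption, wordWeight] at hw this ⊢
          omega

theorem eval_option_toList (o : Option Letter) : eval (o.toList.map some) = permOption o := by
  cases o <;> simp [eval, permOption]

theorem wordWeight_option_toList (o : Option Letter) :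
    wordWeight (o.toList.map some) = weightOption o := by
  cases o <;> simp [wordWeight, weightOption]

/-- Induction on the weight. Conjugation preserves the order, so the normal form may be rotated
cyclically: either it becomes alternating, or two neighbours cancel or merge and the weight drops.
-/
theorem hasTwoPowerOrder_eval (w : List (Option Letter)) : HasTwoPowerOrder (eval w) := by
  induction hn : wordWeight w using Nat.strong_induction_on generalizing w with
  | _ n ih =>
    replace ih : ∀ v, wordWeight v < wordWeight w → HasTwoPowerOrder (eval v) :=
      fun v hv => ih _ (hn ▸ hv) v rfl
    obtain ⟨ε, xs, δ, h, hw⟩ := exists_normalForm w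
    rw [h]
    rcases ε with _ | x <;> rcases δ with _ | _ <;>
      simp only [permOption, weightOption, eval, wordWeight, one_mul, mul_one, zero_add, add_zero,
        if_true, if_false, Bool.false_eq_true] at hw ⊢
    · exact hasTwoPowerOrder_alternating xs fun v hv => ih v (hv.trans_le hw)
    · rcases xs with _ | ⟨y, ys⟩
      · simpa [alternating, eval] using HasTwoPowerOrder.of_mul_self a_mul_self
      · apply HasTwoPowerOrder.mul_comm
        rw [alternating, eval, ← mul_assoc, a_mul_self, one_mul]
        apply ih
        simp only [alternating, wordWeight] at hw ⊢
        omega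
    · rcases xs.eq_nil_or_concat with rfl | ⟨ys, y, rfl⟩
      · simpa [alternating, eval] using HasTwoPowerOrder.of_mul_self x.perm_mul_self
      · apply HasTwoPowerOrder.mul_comm
        have hm := weightOption_merge_lt y x
        have : eval (alternating (ys ++ [y])) * x.perm =
            eval (alternating ys ++ none :: (y.merge x).toList.map some) := by
          simp [alternating_append, alternating, eval_append, eval, eval_option_toList,
            permOption_merge, mul_assoc]
        simp only [List.concat_eq_append] at hw ⊢
        rw [this]
        apply ih
        simp only [alternating_append, wordWeight_append, alternating, wordWeight,
          wordWeight_option_toList] at hw ⊢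
        omega
    -- Moving the final `a` to the front turns `x (a x₁ ⋯ a xₖ) a` into an alternating word of the
    -- same weight.
    · apply HasTwoPowerOrder.mul_comm
      exact hasTwoPowerOrder_alternating (x :: xs) fun v hv => ih v <| hv.trans_le <| by
        simp only [alternating, wordWeight]
        omega

theorem exists_eval_eq {g : Equiv.Perm (List Bool)} (hg : g ∈ grigorchukGroup) :
    ∃ w, eval w = g := by
  have hinv : ∀ x ∈ ({a, b, c, d} : Set (Equiv.Perm (List Bool))), x⁻¹ = x := by
    rintro x (rfl | rfl | rfl | rfl)
    exacts [inv_eq_of_mul_eq_one_left a_mul_self, inv_eq_of_mul_eq_one_left b_mul_self,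
      inv_eq_of_mul_eq_one_left c_mul_self, inv_eq_of_mul_eq_one_left d_mul_self]
  have hmul : ∀ x ∈ ({a, b, c, d} : Set (Equiv.Perm (List Bool))), ∀ w, ∃ v, eval v = x * eval w := by
    rintro x (rfl | rfl | rfl | rfl) w
    exacts [⟨none :: w, rfl⟩, ⟨some .b :: w, rfl⟩, ⟨some .c :: w, rfl⟩, ⟨some .d :: w, rfl⟩]
  induction hg using Subgroup.closure_induction_left with
  | one => exact ⟨[], rfl⟩
  | mul_left x hx y _ ih =>
    obtain ⟨w, rfl⟩ := ih
    exact hmul x hx w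
  | inv_mul_cancel x hx y _ ih =>
    obtain ⟨w, rfl⟩ := ih
    rw [hinv x hx]
    exact hmul x hx w

theorem isPGroup_grigorchukGroup : IsPGroup 2 grigorchukGroup := by
  rintro ⟨g, hg⟩
  obtain ⟨w, rfl⟩ := exists_eval_eq hg
  obtain ⟨k, hk⟩ := hasTwoPowerOrder_eval w
  exact ⟨k, Subtype.ext hk⟩

instance : Group.FG grigorchukGroup :=
  (Group.fg_iff_subgroup_fg _).2 ((Subgroup.fg_iff _).2 ⟨_, rfl, by simp⟩)

-- Residual finiteness of the Grigorchuk group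

theorem length_eval (u : List (Option Letter)) (w : List Bool) :
    (eval u w).length = w.length := by
  have hA : ∀ w, (actA w).length = w.length := by
    intro w
    cases w <;> simp [actA]
  have hBCD : ∀ w, (actB w).length = w.length ∧ (actC w).length = w.length ∧
      (actD w).length = w.length := by
    intro w
    induction w with
    | nil => simp [actB, actC, actD]
    | cons x w ih => cases x <;> simp [actB, actC, actD, hA, ih]
  induction u with
  | nil => rfl
  | cons x u ih =>
    rcases x with _ | _ | _ | _
    exacts [(hA _).trans ih, (hBCD _).1.trans ih, (hBCD _).2.1.trans ih, (hBCD _).2.2.trans ih]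

/-- The levels of the tree are finite and preserved, so the stabilizer of a vertex moved by `g` has
finite index; its normal core avoids `g`. -/
theorem exists_finiteIndex_notMem {g : grigorchukGroup} (hg : g ≠ 1) :
    ∃ N : Subgroup grigorchukGroup, N.Normal ∧ N.FiniteIndex ∧ g ∉ N := by
  obtain ⟨w, hw⟩ : ∃ w, g.1 w ≠ w := by
    by_contra! h
    exact hg (Subtype.ext (Equiv.ext h))
  have hfin : (MulAction.orbit grigorchukGroup w).Finite := by
    refine (List.finite_length_eq Bool w.length).subset ?_
    rintro _ ⟨⟨h, hh⟩, rfl⟩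
    obtain ⟨u, rfl⟩ := exists_eval_eq hh
    exact length_eval u w
  have : (MulAction.stabilizer grigorchukGroup w).FiniteIndex := by
    refine ⟨?_⟩
    rw [MulAction.index_stabilizer]
    exact ((Set.ncard_pos hfin).2 (MulAction.nonempty_orbit w)).ne'
  exact ⟨_, (MulAction.stabilizer grigorchukGroup w).normalCore_normal, inferInstance,
    fun h => hw (Subgroup.normalCore_le _ h)⟩

end Grigorchuk

-- Soluble groups whose finite quotients are p-groups

/-- Nakayama's lemma over ℤ: as `nB = B`, some `r ≡ 1` mod `n` annihilates `B`. It is nonzero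
because `n ≠ 1`, so `B` is torsion. -/
theorem CommGroup.finite_of_fg_of_forall_exists_pow {B : Type*} [CommGroup B] [Group.FG B] {n : ℕ}
    (hn : n ≠ 1) (h : ∀ b : B, ∃ c, c ^ n = b) : Finite B := by
  have hfg : (⊤ : Submodule ℤ (Additive B)).FG := by
    have : AddGroup.FG (Additive B) := inferInstance
    exact Module.Finite.iff_addGroup_fg.2 this |>.fg_top
  obtain ⟨r, hr, hr0⟩ := Submodule.exists_sub_one_mem_and_smul_eq_zero_of_fg_of_le_smul
    (Ideal.span {(n : ℤ)}) (⊤ : Submodule ℤ (Additive B)) hfg <| by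
      intro b _
      obtain ⟨c, hc⟩ := h b.toMul
      have : b = (n : ℤ) • Additive.ofMul c := by
        rw [natCast_zsmul, ← ofMul_pow, hc]
        rfl
      rw [this]
      exact Submodule.smul_mem_smul (Ideal.mem_span_singleton_self _) trivial
  have hr1 : r ≠ 0 := by
    rintro rfl
    rw [Ideal.mem_span_singleton] at hr
    have := Int.natAbs_dvd_natAbs.2 hr
    simp at this
    exact hn this
  have htors : IsMulTorsion B := by
    intro b
    rw [isOfFinOrder_iff_zpow_eq_one]
    exact ⟨r, hr1, hr0 (Additive.ofMul b) trivial⟩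
  exact CommGroup.finite_of_fg_isMulTorsion B htors

theorem CommGroup.finiteIndex_range_powMonoidHom {B : Type*} [CommGroup B] [Group.FG B] {n : ℕ}
    (hn : 0 < n) : (powMonoidHom n : B →* B).range.FiniteIndex := by
  have htors : IsMulTorsion (B ⧸ (powMonoidHom n : B →* B).range) := by
    intro q
    obtain ⟨b, rfl⟩ := QuotientGroup.mk_surjective q
    rw [isOfFinOrder_iff_pow_eq_one]
    exact ⟨n, hn, (QuotientGroup.eq_one_iff (b ^ n)).2 ⟨b, rfl⟩⟩
  have := CommGroup.finite_of_fg_isMulTorsion (B ⧸ (powMonoidHom n : B →* B).range) htors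
  exact Subgroup.finiteIndex_of_finite_quotient

/-- The finite quotients of `G` are `p`-groups. -/
def FiniteQuotientsArePGroups (p : ℕ) (G : Type*) [Group G] : Prop :=
  ∀ N : Subgroup G, ∀ _ : N.Normal, N.FiniteIndex → IsPGroup p (G ⧸ N)

theorem FiniteQuotientsArePGroups.of_surjective {p : ℕ} {G H : Type*} [Group G] [Group H]
    (h : FiniteQuotientsArePGroups p G) (f : G →* H) (hf : Function.Surjective f) :
    FiniteQuotientsArePGroups p H := by
  intro N hN hfin
  have : (N.comap f).FiniteIndex := ⟨by
    rw [Subgroup.index_comap_of_surjective _ hf]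
    exact hfin.index_ne_zero⟩
  refine (h (N.comap f) inferInstance this).of_surjective
    (QuotientGroup.map (N.comap f) N f le_rfl) ?_
  exact QuotientGroup.map_surjective_of_surjective _ _ _
    ((QuotientGroup.mk'_surjective N).comp hf) _

-- For a prime `q ≠ p`, the subgroup `B^q` is normal of finite index in `G`. So `B/B^q` is both a
-- p-group and of exponent dividing `q`, hence trivial, and `B` is finitely generated and
-- q-divisible.
open scoped IsMulCommutative in
theorem finite_of_commutative_finiteIndex {p : ℕ} [Fact p.Prime] {G : Type*} [Group G] [Group.FG G]
    (h : FiniteQuotientsArePGroups p G) (B : Subgroup G) [B.Normal] [B.FiniteIndex]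
    [IsMulCommutative B] : Finite G := by
  obtain ⟨q, hpq, hq⟩ := Nat.exists_infinite_primes (p + 1)
  have hcop : p.Coprime q := (Nat.coprime_primes Fact.out hq).2 (by omega)
  have : Group.FG B := Subgroup.fg_of_index_ne_zero B
  have hfin := CommGroup.finiteIndex_range_powMonoidHom (B := B) hq.pos
  let C : Subgroup G := (powMonoidHom q : B →* B).range.map B.subtype
  have hC : C.Normal := by
    refine ⟨?_⟩
    rintro _ ⟨_, ⟨b, rfl⟩, rfl⟩ g
    refine ⟨_, ⟨⟨g * b * g⁻¹, Subgroup.Normal.conj_mem ‹_› _ b.2 g⟩, rfl⟩, ?_⟩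
    simp [conj_pow]
  have hCfin : C.FiniteIndex := ⟨by
    rw [Subgroup.index_map_subtype]
    exact mul_ne_zero hfin.index_ne_zero Subgroup.FiniteIndex.index_ne_zero⟩
  have : Finite B := by
    refine CommGroup.finite_of_fg_of_forall_exists_pow (n := q) hq.one_lt.ne' fun b => ?_
    obtain ⟨k, hk⟩ := h C hC hCfin (b : G)
    rw [← QuotientGroup.mk_pow, QuotientGroup.eq_one_iff] at hk
    obtain ⟨_, ⟨c, rfl⟩, hc⟩ := hk
    have hc' : c ^ q = b ^ p ^ k := Subtype.ext hc
    obtain ⟨u, v, huv⟩ := Nat.isCoprime_iff_coprime.2 (hcop.pow_left k)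
    -- From `c^q = b^(p^k)` and `u p^k + v q = 1`, this is a `q`-th root of `b`.
    refine ⟨c ^ u * b ^ v, ?_⟩
    calc (c ^ u * b ^ v) ^ q = (c ^ q) ^ u * b ^ (v * (q : ℤ)) := by
          rw [mul_pow, zpow_mul, zpow_natCast, ← zpow_natCast, ← zpow_mul, mul_comm u, zpow_mul,
            zpow_natCast]
      _ = b ^ (u * ((p ^ k : ℕ) : ℤ) + v * (q : ℤ)) := by
          rw [hc', zpow_add, mul_comm u, zpow_mul, zpow_natCast, zpow_mul, zpow_natCast]
      _ = b := by rw [huv, zpow_one]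
  have : Finite (G ⧸ B) := Subgroup.finite_quotient_of_finiteIndex
  exact Finite.of_subgroup_quotient B

open scoped commutatorElement in
theorem finite_of_isSolvable {p : ℕ} [Fact p.Prime] {G : Type*} [Group G] [Group.FG G]
    (h : FiniteQuotientsArePGroups p G) [hs : Group.IsSolvable G] : Finite G := by
  have key : ∀ n, (derivedSeries G n).FiniteIndex := by
    intro n
    induction n with
    | zero => exact inferInstanceAs (⊤ : Subgroup G).FiniteIndex
    | succ n ih =>
      -- Modulo the next derived subgroup, the current one becomes abelian of finite index, so the
      -- quotient is finite.
      let π := QuotientGroup.mk' (derivedSeries G (n + 1))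
      have hπ : Function.Surjective π := QuotientGroup.mk'_surjective _
      let B := (derivedSeries G n).map π
      have hB : B.Normal := Subgroup.Normal.map inferInstance π hπ
      have hBfin : B.FiniteIndex := ⟨fun h0 => ih.index_ne_zero <|
        Nat.eq_zero_of_zero_dvd (h0 ▸ Subgroup.index_map_dvd _ hπ)⟩
      have hcomm : IsMulCommutative B := by
        refine ⟨⟨?_⟩⟩
        rintro ⟨_, x, hx, rfl⟩ ⟨_, y, hy, rfl⟩
        refine Subtype.ext ?_
        change π x * π y = π y * π x
        rw [← map_mul, ← map_mul]
        refine (QuotientGroup.eq.2 ?_).symm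
        have : (y * x)⁻¹ * (x * y) = ⁅x⁻¹, y⁻¹⁆ := by simp [commutatorElement_def, mul_assoc]
        rw [this]
        exact Subgroup.commutator_mem_commutator (inv_mem hx) (inv_mem hy)
      have := finite_of_commutative_finiteIndex (h.of_surjective π hπ) B
      exact Subgroup.finiteIndex_of_finite_quotient
  obtain ⟨n, hn⟩ := (Group.isSolvable_def G).1 hs
  have h0 := (key n).index_ne_zero
  rw [hn, Subgroup.index_bot] at h0
  exact Nat.finite_of_card_ne_zero h0

-- When a homomorphism induces an isomorphism of completions

namespace DirectedNormalFamily.Completion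

section

variable {G H : Type*} [Group G] [Group H] (ℳ : DirectedNormalFamily G)
  (𝒩 : DirectedNormalFamily H) (ψ : G →* H) (hψ : ∀ N ∈ 𝒩.carrier, N.comap ψ ∈ ℳ.carrier)

theorem map_comap_injective (N : Subgroup H) [N.Normal] :
    Function.Injective (QuotientGroup.map (N.comap ψ) N ψ le_rfl) := by
  rw [injective_iff_map_eq_one]
  intro q hq
  obtain ⟨g, rfl⟩ := QuotientGroup.mk_surjective q
  rw [QuotientGroup.eq_one_iff, Subgroup.mem_comap, ← QuotientGroup.eq_one_iff]
  exact hq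

/-- Since the image of `ψ` meets every coset of some `K ≤ M ⊓ N` in the family, inclusions can be
tested on elements of that image. -/
theorem le_of_comap_le (hsurj : ∀ N ∈ 𝒩.carrier, ∀ h : H, ∃ g : G, h⁻¹ * ψ g ∈ N)
    {M N : Subgroup H} (hM : M ∈ 𝒩.carrier) (hN : N ∈ 𝒩.carrier) (h : M.comap ψ ≤ N.comap ψ) :
    M ≤ N := by
  intro x hx
  obtain ⟨K, hK, hKMN⟩ := 𝒩.directed M hM N hN
  obtain ⟨g, hg⟩ := hsurj K hK x
  have hgM : ψ g ∈ M := by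
    have := M.mul_mem hx (hKMN hg).1
    rwa [mul_inv_cancel_left] at this
  have hgN : ψ g ∈ N := h hgM
  have := N.mul_mem hgN (N.inv_mem (hKMN hg).2)
  rwa [mul_inv_rev, inv_inv, mul_inv_cancel_left] at this

/-- If the groups in `ℳ` are exactly the preimages of groups in `𝒩`, then `map` is injective. -/
theorem map_injective (hcomap : ∀ M ∈ ℳ.carrier, ∃ N ∈ 𝒩.carrier, N.comap ψ = M) :
    Function.Injective (map ℳ 𝒩 ψ hψ) := by
  rw [injective_iff_map_eq_one]
  intro x hx
  refine Subtype.ext (funext ?_)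
  rintro ⟨M, hM⟩
  obtain ⟨N, hN, rfl⟩ := hcomap M hM
  have := 𝒩.normal N hN
  refine map_comap_injective ψ N ?_
  have h1 := congrArg (proj 𝒩 ⟨N, hN⟩) hx
  rw [map_one] at h1
  exact h1.trans (map_one (QuotientGroup.map (N.comap ψ) N ψ le_rfl)).symm

theorem map_surjective (hcomap : ∀ M ∈ ℳ.carrier, ∃ N ∈ 𝒩.carrier, N.comap ψ = M)
    (hsurj : ∀ N ∈ 𝒩.carrier, ∀ h : H, ∃ g : G, h⁻¹ * ψ g ∈ N) :
    Function.Surjective (map ℳ 𝒩 ψ hψ) := by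
  intro y
  have hex : ∀ N : 𝒩.carrier, ∃ g : G, (QuotientGroup.mk (ψ g) : H ⧸ (N : Subgroup H)) = y.1 N := by
    intro N
    obtain ⟨h, hh⟩ := QuotientGroup.mk_surjective (y.1 N)
    obtain ⟨g, hg⟩ := hsurj N N.2 h
    exact ⟨g, (QuotientGroup.eq.2 hg).symm.trans hh⟩
  choose r hr using hex
  choose s hs hsM using hcomap
  -- A representative of the coordinate at `N` also represents the coordinate at any larger `M`.
  have key : ∀ M N : 𝒩.carrier, (N : Subgroup H) ≤ M → (r N)⁻¹ * r M ∈ (M : Subgroup H).comap ψ := by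
    intro M N hNM
    rw [Subgroup.mem_comap, map_mul, map_inv, ← QuotientGroup.eq, hr M, ← y.2 M N hNM, ← hr N]
    rfl
  refine ⟨⟨fun M => QuotientGroup.mk (r ⟨s M M.2, hs M M.2⟩), ?_⟩, ?_⟩
  · intro M N hNM
    refine QuotientGroup.eq.2 ?_
    have hle : s N N.2 ≤ s M M.2 := le_of_comap_le 𝒩 ψ hsurj (hs _ _) (hs _ _) <| by
      rwa [hsM, hsM]
    have := key ⟨s M M.2, hs M M.2⟩ ⟨s N N.2, hs N N.2⟩ hle
    rwa [hsM] at this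
  · refine Subtype.ext (funext fun N => ?_)
    have hN := hψ N N.2
    -- The chosen group with the same preimage as `N` is not known to be `N` itself; inclusion is
    -- enough.
    have hle : s _ hN ≤ N := le_of_comap_le 𝒩 ψ hsurj (hs _ _) N.2 (hsM _ _).le
    refine Eq.trans ?_ (hr N)
    exact QuotientGroup.eq.2 (by simpa using key N ⟨s _ hN, hs _ hN⟩ hle)

/-- A criterion for `map` to be an isomorphism of topological groups. -/
theorem exists_continuousMulEquiv (hcomap : ∀ M ∈ ℳ.carrier, ∃ N ∈ 𝒩.carrier, N.comap ψ = M)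
    (hsurj : ∀ N ∈ 𝒩.carrier, ∀ h : H, ∃ g : G, h⁻¹ * ψ g ∈ N) :
    ∃ e : ℳ.Completion ≃ₜ* 𝒩.Completion, ∀ x, e x = map ℳ 𝒩 ψ hψ x := by
  let e : ℳ.Completion ≃* 𝒩.Completion := MulEquiv.ofBijective (map ℳ 𝒩 ψ hψ)
    ⟨map_injective ℳ 𝒩 ψ hψ hcomap, map_surjective ℳ 𝒩 ψ hψ hcomap hsurj⟩
  refine ⟨⟨e, continuous_map ℳ 𝒩 ψ hψ, ?_⟩, fun _ => rfl⟩
  refine continuous_iInf_rng.2 ?_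
  rintro ⟨M, hM⟩
  obtain ⟨N, hN, rfl⟩ := hcomap M hM
  have := 𝒩.normal N hN
  let f := QuotientGroup.map (N.comap ψ) N ψ le_rfl
  refine continuous_induced_rng.2 (continuous_iInf_dom (i := ⟨N, hN⟩) ?_)
  -- The coordinate of the inverse at `ψ⁻¹(N)` depends only on the coordinate at `N`, hence is
  -- continuous.
  have hinv : ∀ y : 𝒩.Completion, proj ℳ ⟨N.comap ψ, hM⟩ (e.symm y) =
      Function.invFun f (proj 𝒩 ⟨N, hN⟩ y) := by
    intro y
    obtain ⟨x, rfl⟩ := e.surjective y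
    rw [e.symm_apply_apply]
    exact (Function.leftInverse_invFun (map_comap_injective ψ N) _).symm
  have h1 : @Continuous _ _ ⊥ ⊥ (Function.invFun f) := continuous_bot
  have h2 := @Continuous.comp _ _ _ (TopologicalSpace.induced (proj 𝒩 ⟨N, hN⟩) ⊥) ⊥ ⊥ _ _ h1
    continuous_induced_dom
  refine Eq.mp ?_ h2
  congr 1
  exact (funext hinv).symm

end

end DirectedNormalFamily.Completion

-- Subgroups of a pro-p completion and the main theorem

open DirectedNormalFamily Completion

theorem IsPGroup.of_mem_solubleFamily {p : ℕ} [Fact p.Prime] {G : Type*} [Group G]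
    {N : Subgroup G} [N.Normal] [N.FiniteIndex] (h : IsPGroup p (G ⧸ N)) :
    N ∈ (solubleFamily G).carrier := by
  have : Finite (G ⧸ N) := Subgroup.finite_quotient_of_finiteIndex
  have := h.isNilpotent
  exact ⟨inferInstance, inferInstance⟩

theorem FiniteQuotientsArePGroups.finiteIndex {p : ℕ} [Fact p.Prime] {G : Type*} [Group G]
    [Group.FG G] (h : FiniteQuotientsArePGroups p G) {N : Subgroup G}
    (hN : N ∈ (solubleFamily G).carrier) : N.FiniteIndex := by
  obtain ⟨_, _⟩ := hN
  have := finite_of_isSolvable (h.of_surjective _ (QuotientGroup.mk'_surjective N))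
  exact Subgroup.finiteIndex_of_finite_quotient

theorem mem_proPFamily_iff {p : ℕ} [Fact p.Prime] {G : Type*} [Group G] {N : Subgroup G} :
    N ∈ (proPFamily p G).carrier ↔ ∃ _ : N.Normal, N.FiniteIndex ∧ IsPGroup p (G ⧸ N) := by
  constructor
  · rintro ⟨hN, k, hk⟩
    exact ⟨hN, ⟨by rw [hk]; exact pow_ne_zero _ (Fact.out : p.Prime).ne_zero⟩,
      IsPGroup.of_card (hk ▸ (N.index_eq_card).symm)⟩
  · rintro ⟨hN, _, hp⟩
    have : Finite (G ⧸ N) := Subgroup.finite_quotient_of_finiteIndex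
    exact ⟨hN, N.index_eq_card ▸ IsPGroup.iff_card.1 hp⟩

section DenseSubgroup

variable {p : ℕ} [Fact p.Prime] {G : Type*} [Group G] (Δ : Subgroup (ProPCompletion p G))

/-- The intersection of `Δ` with the kernel of the projection to `G ⧸ N`. -/
abbrev kerProj (N : (proPFamily p G).carrier) : Subgroup Δ :=
  (proj (proPFamily p G) N).ker.subgroupOf Δ

theorem kerProj_mem_solubleFamily (N : (proPFamily p G).carrier) :
    kerProj Δ N ∈ (solubleFamily Δ).carrier := by
  obtain ⟨_, _, hp⟩ := mem_proPFamily_iff.1 N.2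
  have : Finite (G ⧸ (N : Subgroup G)) := Subgroup.finite_quotient_of_finiteIndex
  have := hp.isNilpotent
  let f : Δ →* G ⧸ (N : Subgroup G) := (proj (proPFamily p G) N).comp Δ.subtype
  have hf : kerProj Δ N = f.ker := rfl
  rw [hf]
  exact ⟨inferInstance, Group.isSolvable_of_isSolvable_injective (QuotientGroup.kerLift_injective f)⟩

theorem isResiduallySoluble_of_le_proPCompletion : IsResiduallySoluble Δ := by
  intro δ hδ
  obtain ⟨N, hN⟩ : ∃ N, δ.1.1 N ≠ 1 := by
    by_contra! h
    exact hδ (Subtype.ext (Subtype.ext (funext h)))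
  exact ⟨_, kerProj_mem_solubleFamily Δ N, hN⟩

/-- `N` is the trace of an open `M`, and the open coset `δM` meets the dense image of `G`. -/
theorem exists_inv_mul_mem (hcsp : HasCongruenceSubgroupProperty Δ) (ψ : G →* Δ)
    (hψ : ∀ g, (ψ g : ProPCompletion p G) = toProPCompletion p G g) (N : Subgroup Δ) (hN : N.Normal)
    (hfin : N.FiniteIndex) (δ : Δ) : ∃ g, δ⁻¹ * ψ g ∈ N := by
  obtain ⟨M, -, hM, rfl⟩ := hcsp N hN hfin
  obtain ⟨g, hg⟩ := (denseRange_of (proPFamily p G)).exists_mem_open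
    (hM.preimage (continuous_const_mul (δ : ProPCompletion p G)⁻¹)) ⟨δ, by simp⟩
  refine ⟨g, ?_⟩
  rw [Subgroup.mem_subgroupOf]
  simpa [hψ] using hg

theorem finiteQuotientsArePGroups_of_hasCongruenceSubgroupProperty (hG : IsPGroup p G)
    (hcsp : HasCongruenceSubgroupProperty Δ) (ψ : G →* Δ)
    (hψ : ∀ g, (ψ g : ProPCompletion p G) = toProPCompletion p G g) :
    FiniteQuotientsArePGroups p Δ := by
  intro N hN hfin
  refine hG.of_surjective ((QuotientGroup.mk' N).comp ψ) fun q => ?_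
  obtain ⟨δ, rfl⟩ := QuotientGroup.mk_surjective q
  obtain ⟨g, hg⟩ := exists_inv_mul_mem Δ hcsp ψ hψ N hN hfin δ
  exact ⟨g, (QuotientGroup.eq.2 hg).symm⟩

end DenseSubgroup

theorem mainTheorem2
    (Δ : Subgroup (ProPCompletion 2 grigorchukGroup))
    (hfg : Δ.FG)
    (hdense : Dense (Δ : Set (ProPCompletion 2 grigorchukGroup)))
    (hlt : (toProPCompletion 2 grigorchukGroup).range < Δ)
    (hcsp : HasCongruenceSubgroupProperty Δ)
    (ψ : grigorchukGroup →* Δ)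
    (hψ : ∀ γ : grigorchukGroup,
      (ψ γ : ProPCompletion 2 grigorchukGroup) = toProPCompletion 2 grigorchukGroup γ) :
    IsResiduallySoluble grigorchukGroup ∧ IsResiduallySoluble Δ ∧
      Function.Injective ψ ∧ ¬ Function.Bijective ψ ∧
      ∃ e : TrueProsolubleCompletion grigorchukGroup ≃ₜ* TrueProsolubleCompletion Δ,
        ∀ x, e x = TrueProsolubleCompletion.map ψ x := by
  have h2 := Grigorchuk.isPGroup_grigorchukGroup
  have hΓ : FiniteQuotientsArePGroups 2 grigorchukGroup := fun N _ _ => h2.to_quotient N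
  have : Group.FG Δ := (Group.fg_iff_subgroup_fg Δ).2 hfg
  have hΔ := finiteQuotientsArePGroups_of_hasCongruenceSubgroupProperty Δ h2 hcsp ψ hψ
  refine ⟨fun g hg => ?_, isResiduallySoluble_of_le_proPCompletion Δ, ?_, fun hbij => ?_, ?_⟩
  · obtain ⟨N, hN, _, hgN⟩ := Grigorchuk.exists_finiteIndex_notMem hg
    exact ⟨N, (h2.to_quotient N).of_mem_solubleFamily, hgN⟩
  · rw [injective_iff_map_eq_one]
    intro g hg
    by_contra hne
    -- Finite quotients of a 2-group have 2-power order, so residual finiteness already separates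
    -- points in the pro-2 completion.
    obtain ⟨N, hN, hfin, hgN⟩ := Grigorchuk.exists_finiteIndex_notMem hne
    have hmem : N ∈ (proPFamily 2 grigorchukGroup).carrier :=
      mem_proPFamily_iff.2 ⟨hN, hfin, h2.to_quotient N⟩
    have h1 : toProPCompletion 2 grigorchukGroup g = 1 := by rw [← hψ, hg, Subgroup.coe_one]
    have h3 := congrArg (proj _ ⟨N, hmem⟩) h1
    exact hgN ((QuotientGroup.eq_one_iff g).1 h3)
  · refine hlt.not_ge fun δ hδ => ?_
    obtain ⟨g, hg⟩ := hbij.2 ⟨δ, hδ⟩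
    exact ⟨g, by rw [← hψ, hg]⟩
  · refine exists_continuousMulEquiv _ _ ψ (comap_mem_solubleFamily ψ) (fun M hM => ?_)
      fun N hN => exists_inv_mul_mem Δ hcsp ψ hψ N hN.1 (hΔ.finiteIndex hN)
    -- A normal `M` with soluble quotient has 2-power index, so it indexes a coordinate of the pro-2
    -- completion; it is the preimage of the kernel of that coordinate on `Δ`.
    have hMn := hM.1
    have hmem : M ∈ (proPFamily 2 grigorchukGroup).carrier :=
      mem_proPFamily_iff.2 ⟨hMn, hΓ.finiteIndex hM, h2.to_quotient M⟩
    refine ⟨_, kerProj_mem_solubleFamily Δ ⟨M, hmem⟩, ?_⟩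
    ext g
    rw [Subgroup.mem_comap, Subgroup.mem_subgroupOf, hψ, MonoidHom.mem_ker]
    exact QuotientGroup.eq_one_iff g
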